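/- **Notation.** $|\cdot|$ is the Euclidean norm. A function $\alpha:\mathbb R_{\ge0}\to\mathbb R_{\ge0}$ is of class $\mathcal K$ if it is continuous, strictly increasing and $\alpha(0)=0$; it is of class $\mathcal K_\infty$ if in addition it is unbounded. A function $\beta:\mathbb R_{\ge0}\times\mathbb R_{\ge0}\to\mathbb R_{\ge0}$ is of class $\mathcal{KL}$ if $\beta(\cdot,t)\in\mathcal K$ for every $t\ge0$, $\beta(s,\cdot)$ is strictly decreasing for every $s>0$, and $\lim_{t\to\infty}\beta(s,t)=0$ for every $s\ge 0$. Let $n,q\in\mathbb N_0$ and consider the discrete-time model $x_{k+1}=\bar F(x_k,e_k,T_k)$, $k\in\mathbb N_0$, with states $x_k\in\mathbb R^n$, inputs $e_k\in\mathbb R^q$ and sampling periods $T_k>0$, where $\bar F$ is an arbitrary (possibly only partially defined) map from $\mathbb R^n\times\mathbb R^q\times\mathbb R_{>0}$ to $\mathbb R^n$. Every condition below that involves a value of $\bar F$ or a solution includes the requirement that it is defined. The model is *semiglobally input-to-state stable under varying sampling rate* (S-ISS-VSR) if there exist $\beta\in\mathcal{KL}$ and $\gamma\in\mathcal K_\infty$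 such that for every $M\ge0$ and $E\ge0$ there exists $T^\star=T^\star(M,E)>0$ such that the solutions satisfy $$|x_k|\le\beta\Big(|x_0|,\sum_{i=0}^{k-1}T_i\Big)+\gamma\Big(\sup_{0\le i\le k-1}|e_i|\Big)$$ for all $k\in\mathbb N_0$, all sequences $\{T_i\}$ in $(0,T^\star)$, all $|x_0|\le M$ and all sequences $\{e_i\}$ with $|e_i|\le E$ for all $i$; for $k=0$ the sum and the term $\gamma(\cdot)$ are $0$. **Theorem.** The model is S-ISS-VSR if and only if the following four conditions all hold: (i) There exists $\mathring T>0$ such that $\bar F(0,0,T)=0$ for all $T\in(0,\mathring T)$. (ii) There exists $\hat T>0$ such that for every $\epsilon>0$ there exists $\delta=\delta(\epsilon)>0$ such that $|\bar F(x,e,T)|<\epsilon$ whenever $|x|\le\delta$, $|e|\le\delta$ and $T\in(0,\hat T)$. (iii) For every $M\ge0$ and $E\ge0$ there exist $C=C(M,E)>0$ and $\check T=\check T(M,E)>0$, with $C(\cdot,\cdot)$ nondecreasing in each variable and $\check T(\cdot,\cdot)$ nonincreasing in each variable, such that $|\bar F(x,e,T)|\le C$ for all $|x|\le M$, $|e|\le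 E$ and $T\in(0,\check T)$. (iv) There exist $\alpha_1,\alpha_2,\alpha_3\in\mathcal K_\infty$ and $\rho\in\mathcal K$ such that for every $M\ge0$ and $E\ge0$ there exist $\tilde T=\tilde T(M,E)>0$ and $V=V_{M,E}:\mathbb R^n\to\mathbb R_{\ge0}\cup\{\infty\}$ such that $\alpha_1(|x|)\le V(x)$ for all $x\in\mathbb R^n$, $V(x)\le\alpha_2(|x|)$ for all $|x|\le M$, and $$V(\bar F(x,e,T))-V(x)\le-T\,\alpha_3(|x|)$$ for all $x,e,T$ with $\rho(|e|)\le|x|\le M$, $|e|\le E$ and $T\in(0,\tilde T)$. -/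

import Mathlib

open scoped NNReal ENNReal Topology

/-- Class `𝒦`: strictly increasing continuous functions `ℝ≥0 → ℝ≥0` vanishing at zero. -/
def IsClassK (α : ℝ≥0 → ℝ≥0) : Prop :=
  StrictMono α ∧ Continuous α ∧ α 0 = 0

/-- Class `𝒦∞`: unbounded functions of class `𝒦`. -/
def IsClassKInf (α : ℝ≥0 → ℝ≥0) : Prop :=
  IsClassK α ∧ ¬ BddAbove (Set.range α)

/-- Class `𝒦ℒ`: `β(·,t)` is of class `𝒦` for every `t ≥ 0`, and `β(s,·)` decreases to zero, strictly
for `s > 0` (for `s = 0` it vanishes identically). -/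
def IsClassKL (β : ℝ≥0 → ℝ≥0 → ℝ≥0) : Prop :=
  (∀ t, IsClassK fun s => β s t) ∧
    (∀ s, 0 < s → StrictAnti (β s)) ∧
    ∀ s, Filter.Tendsto (β s) Filter.atTop (𝓝 0)

/-- A discrete-time model `x_{k+1} = F̄(x_k, e_k, T_k)` with state in `ℝⁿ`, input in `ℝ^q` and
sampling period `T`. The map `F̄` may be partial: `y ∈ F x e T` means that `F̄(x,e,T)` is defined
and equals `y`. Only values at `T > 0` are ever used. -/
abbrev SampledModel (n q : ℕ) : Type :=
  EuclideanSpace ℝ (Fin n) → EuclideanSpace ℝ (Fin q) → ℝ≥0 →. EuclideanSpace ℝ (Fin n)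

namespace SampledModel

variable {n q : ℕ}

/-- `x` is the (everywhere defined) solution with initial state `ξ`, input sequence `e` and
sampling-period sequence `T`. As `F` is single-valued, there is at most one. -/
def IsSolution (F : SampledModel n q) (ξ : EuclideanSpace ℝ (Fin n))
    (e : ℕ → EuclideanSpace ℝ (Fin q)) (T : ℕ → ℝ≥0) (x : ℕ → EuclideanSpace ℝ (Fin n)) : Prop :=
  x 0 = ξ ∧ ∀ k, x (k + 1) ∈ F (x k) (e k) (T k)

/-- Semiglobal input-to-state stability under varying sampling rate. For `k = 0` the sum and the
supremum are over the empty set, hence `0`. -/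
def IsSISSVSR (F : SampledModel n q) : Prop :=
  ∃ β : ℝ≥0 → ℝ≥0 → ℝ≥0, ∃ γ : ℝ≥0 → ℝ≥0, IsClassKL β ∧ IsClassKInf γ ∧
    ∀ M E : ℝ≥0, ∃ Tstar : ℝ≥0, 0 < Tstar ∧
      ∀ T : ℕ → ℝ≥0, (∀ i, 0 < T i ∧ T i < Tstar) →
      ∀ ξ : EuclideanSpace ℝ (Fin n), ‖ξ‖₊ ≤ M →
      ∀ e : ℕ → EuclideanSpace ℝ (Fin q), (∀ i, ‖e i‖₊ ≤ E) →
        ∃ x : ℕ → EuclideanSpace ℝ (Fin n), F.IsSolution ξ e T x ∧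
          ∀ k, ‖x k‖₊ ≤ β ‖ξ‖₊ (∑ i ∈ Finset.range k, T i) +
            γ ((Finset.range k).sup fun i => ‖e i‖₊)

/-- `F̄(0,0,T) = 0` for all sufficiently small `T`. -/
def ZeroAtOrigin (F : SampledModel n q) : Prop :=
  ∃ T₀ : ℝ≥0, 0 < T₀ ∧ ∀ T, 0 < T → T < T₀ → 0 ∈ F 0 0 T

/-- `F̄(x,e,T)` is small for small `(x,e)`, uniformly in small `T`. -/
def UniformlyContinuousAtOrigin (F : SampledModel n q) : Prop :=
  ∃ T₀ : ℝ≥0, 0 < T₀ ∧ ∀ ε : ℝ≥0, 0 < ε → ∃ δ : ℝ≥0, 0 < δ ∧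
    ∀ x e T, ‖x‖₊ ≤ δ → ‖e‖₊ ≤ δ → 0 < T → T < T₀ → ∃ y ∈ F x e T, ‖y‖₊ < ε

/-- `F̄` is bounded on bounded sets, uniformly in small `T`, with monotone bounds `C` and `Tc`. -/
def UniformlyBounded (F : SampledModel n q) : Prop :=
  ∃ C Tc : ℝ≥0 → ℝ≥0 → ℝ≥0,
    (∀ M E, 0 < C M E) ∧ (∀ M E, 0 < Tc M E) ∧
    (∀ E, Monotone fun M => C M E) ∧ (∀ M, Monotone (C M)) ∧
    (∀ E, Antitone fun M => Tc M E) ∧ (∀ M, Antitone (Tc M)) ∧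
    ∀ M E x e T, ‖x‖₊ ≤ M → ‖e‖₊ ≤ E → 0 < T → T < Tc M E → ∃ y ∈ F x e T, ‖y‖₊ ≤ C M E

/-- The Lyapunov-type condition. The decrease `V(F̄(x,e,T)) - V(x) ≤ -T α₃(|x|)` is written
additively in `ℝ≥0∞`; `V(x)` is finite there because `|x| ≤ M`. -/
def HasLyapunovFamily (F : SampledModel n q) : Prop :=
  ∃ α₁ α₂ α₃ ρ : ℝ≥0 → ℝ≥0,
    IsClassKInf α₁ ∧ IsClassKInf α₂ ∧ IsClassKInf α₃ ∧ IsClassK ρ ∧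
    ∀ M E : ℝ≥0, ∃ Tt : ℝ≥0, 0 < Tt ∧ ∃ V : EuclideanSpace ℝ (Fin n) → ℝ≥0∞,
      (∀ x, (α₁ ‖x‖₊ : ℝ≥0∞) ≤ V x) ∧
      (∀ x, ‖x‖₊ ≤ M → V x ≤ (α₂ ‖x‖₊ : ℝ≥0∞)) ∧
      ∀ x e T, ρ ‖e‖₊ ≤ ‖x‖₊ → ‖x‖₊ ≤ M → ‖e‖₊ ≤ E → 0 < T → T < Tt →
        ∃ y ∈ F x e T, V y + (T * α₃ ‖x‖₊ : ℝ≥0) ≤ V x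

end SampledModel

/-! Sufficiency. While `ρ |e_k| ≤ |x_k|`, the function `V` drops by at least `T_k α₃ |x_k|`;
otherwise (ii) and (iii) bound the next state by a gain `χ |e_k|`. A sublevel set of `V` inside the
ball where the estimates hold is invariant, so at each time either `V` has been nonincreasing since
the start, and the summed drops give a 𝒦ℒ bound, or `V` is at most `α₂ ∘ χ` of the input supremum
(`norm_le_of_lyapunov_steps`).

Necessity. Conditions (i)-(iii) are one-step consequences of the estimate. For (iv), `V ξ` is the
supremum, over finite trajectories from `ξ` with `ρ |e_i| ≤ |x_i|`, of the final norm plus `∑ T_i α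
|x_i|` (`worstCost`). Prepending a step gives the decrease and the trajectory of length zero gives
the lower bound. The substance is an upper bound independent of `M` and `E`. Put `κ s = β s 0 + s`
and `ρ r = κ (4 γ r)`: inputs then contribute at most `|ξ| / 4`, so the norm halves within a
settling time depending only on `|ξ|`. The gauge `α` is so flat that one halving from level `s`
costs at most `s * m s` with `m` monotone (`exists_cost_gauge`), and successive halvings sum
geometrically to `2 * (s * m s)` (`sum_cost_le`).

All gauges arise as infima or suprema that are merely monotone; averaging over `[s, 2 * s]` makes
them continuous. -/

/-! ### Smoothing monotone functions by averaging -/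

/-- The average of `W` over `[s, 2 * s]`, written after rescaling as an integral over `[1, 2]`. -/
noncomputable def dyadicAverage (W : ℝ≥0 → ℝ≥0) (s : ℝ≥0) : ℝ≥0 :=
  (∫ u in (1 : ℝ)..2, (W (s * u.toNNReal) : ℝ)).toNNReal

theorem monotone_comp_mul_toNNReal {W : ℝ≥0 → ℝ≥0} (hW : Monotone W) (s : ℝ≥0) :
    Monotone fun u : ℝ => (W (s * u.toNNReal) : ℝ) := fun _ _ h =>
  NNReal.coe_le_coe.2 (hW (mul_le_mul_right (Real.toNNReal_le_toNNReal h) s))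

theorem intervalIntegrable_comp_mul_toNNReal {W : ℝ≥0 → ℝ≥0} (hW : Monotone W) (s : ℝ≥0)
    (a b : ℝ) :
    IntervalIntegrable (fun u : ℝ => (W (s * u.toNNReal) : ℝ)) MeasureTheory.volume a b :=
  (monotone_comp_mul_toNNReal hW s).intervalIntegrable

theorem coe_dyadicAverage (W : ℝ≥0 → ℝ≥0) (s : ℝ≥0) :
    (dyadicAverage W s : ℝ) = ∫ u in (1 : ℝ)..2, (W (s * u.toNNReal) : ℝ) :=
  Real.coe_toNNReal _ (intervalIntegral.integral_nonneg (by norm_num) fun _ _ => NNReal.coe_nonneg _)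

theorem le_dyadicAverage {W : ℝ≥0 → ℝ≥0} (hW : Monotone W) (s : ℝ≥0) :
    W s ≤ dyadicAverage W s := by
  rw [← NNReal.coe_le_coe, coe_dyadicAverage]
  have h := intervalIntegral.integral_mono_on (a := 1) (b := 2) (μ := MeasureTheory.volume)
    (f := fun _ => (W s : ℝ)) (g := fun u : ℝ => (W (s * u.toNNReal) : ℝ)) (by norm_num)
    (by simp) (intervalIntegrable_comp_mul_toNNReal hW s 1 2)
    (fun u hu => NNReal.coe_le_coe.2 (hW (le_mul_of_one_le_right zero_le
      (Real.one_le_toNNReal.2 hu.1))))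
  norm_num at h
  exact h

theorem dyadicAverage_le {W : ℝ≥0 → ℝ≥0} (hW : Monotone W) (s : ℝ≥0) :
    dyadicAverage W s ≤ W (s * 2) := by
  rw [← NNReal.coe_le_coe, coe_dyadicAverage]
  have h := intervalIntegral.integral_mono_on (a := 1) (b := 2) (μ := MeasureTheory.volume)
    (g := fun _ => (W (s * 2) : ℝ)) (f := fun u : ℝ => (W (s * u.toNNReal) : ℝ)) (by norm_num)
    (intervalIntegrable_comp_mul_toNNReal hW s 1 2) (by simp)
    (fun u hu => NNReal.coe_le_coe.2 (hW (mul_le_mul_right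
      (Real.toNNReal_le_iff_le_coe.2 hu.2) s)))
  norm_num at h
  exact h

theorem dyadicAverage_le_dyadicAverage {W W' : ℝ≥0 → ℝ≥0} (hW : Monotone W) (hW' : Monotone W')
    {s s' : ℝ≥0} (h : ∀ u, W (s * u) ≤ W' (s' * u)) : dyadicAverage W s ≤ dyadicAverage W' s' := by
  rw [← NNReal.coe_le_coe, coe_dyadicAverage, coe_dyadicAverage]
  exact intervalIntegral.integral_mono_on (by norm_num)
    (intervalIntegrable_comp_mul_toNNReal hW s 1 2)
    (intervalIntegrable_comp_mul_toNNReal hW' s' 1 2) fun u _ => NNReal.coe_le_coe.2 (h _)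

theorem monotone_dyadicAverage {W : ℝ≥0 → ℝ≥0} (hW : Monotone W) :
    Monotone (dyadicAverage W) := fun _ _ h =>
  dyadicAverage_le_dyadicAverage hW hW fun u => hW (mul_le_mul_left h u)

-- Dominated convergence: a monotone `W` has countably many discontinuities, and for `s ≠ 0` the
-- injective map `u ↦ s * u` meets them for countably many `u > 0` only. At `s = 0` every `u` hits
-- the single point `0`, so continuity of `W` there must be assumed.
open Filter MeasureTheory in
theorem continuousAt_dyadicAverage {W : ℝ≥0 → ℝ≥0} (hW : Monotone W) {s : ℝ≥0}
    (hs : s ≠ 0 ∨ ContinuousAt W 0) : ContinuousAt (dyadicAverage W) s := by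
  refine (continuous_real_toNNReal.continuousAt (x := _)).comp
    (intervalIntegral.continuousAt_of_dominated_interval
      (bound := fun _ => (W ((s + 1) * 2) : ℝ)) ?_ ?_ (by simp) ?_)
  · exact Eventually.of_forall fun r =>
      (monotone_comp_mul_toNNReal hW r).measurable.aestronglyMeasurable
  · filter_upwards [gt_mem_nhds (show s < s + 1 by simp)] with r hr
    refine Eventually.of_forall fun u hu => ?_
    rw [Set.uIoc_of_le (by norm_num)] at hu
    rw [NNReal.norm_eq, NNReal.coe_le_coe]
    exact hW (mul_le_mul' hr.le (Real.toNNReal_le_iff_le_coe.2 hu.2))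
  · have key : ∀ u : ℝ, ContinuousAt W (s * u.toNNReal) →
        ContinuousAt (fun r : ℝ≥0 => (W (r * u.toNNReal) : ℝ)) s := fun u hu =>
      NNReal.continuous_coe.continuousAt.comp
        (ContinuousAt.comp (f := fun r : ℝ≥0 => r * u.toNNReal) hu
          (continuous_mul_const _).continuousAt)
    by_cases h0 : s = 0
    · subst h0
      refine Eventually.of_forall fun u _ => key u ?_
      simpa using hs
    · have hc : ({u : ℝ | 0 < u} ∩ {u : ℝ | ¬ ContinuousAt W (s * u.toNNReal)}).Countable := by
        refine Set.MapsTo.countable_of_injOn (f := fun u : ℝ => s * u.toNNReal)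
          (t := {x | ¬ ContinuousAt W x}) (fun u hu => hu.2) ?_ hW.countable_not_continuousAt
        intro u hu v hv huv
        have := mul_left_cancel₀ h0 huv
        exact (Real.toNNReal_eq_toNNReal_iff hu.1.le hv.1.le).1 this
      filter_upwards [hc.ae_notMem volume] with u hu hu'
      rw [Set.uIoc_of_le (by norm_num)] at hu'
      refine key u ?_
      by_contra hcon
      exact hu ⟨by have := hu'.1; simp only [Set.mem_ofPred_eq]; linarith, hcon⟩

/-! ### Comparison functions from monotone bounds -/

theorem IsClassK.monotone {α : ℝ≥0 → ℝ≥0} (h : IsClassK α) : Monotone α := h.1.monotone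

theorem IsClassK.continuous {α : ℝ≥0 → ℝ≥0} (h : IsClassK α) : Continuous α := h.2.1

theorem IsClassK.map_zero {α : ℝ≥0 → ℝ≥0} (h : IsClassK α) : α 0 = 0 := h.2.2

theorem IsClassK.pos {α : ℝ≥0 → ℝ≥0} (h : IsClassK α) {s : ℝ≥0} (hs : 0 < s) : 0 < α s := by
  simpa [h.map_zero] using h.1 hs

theorem IsClassKInf.exists_lt {α : ℝ≥0 → ℝ≥0} (h : IsClassKInf α) (c : ℝ≥0) : ∃ s, c < α s := by
  obtain ⟨_, ⟨s, rfl⟩, hs⟩ := not_bddAbove_iff.1 h.2 c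
  exact ⟨s, hs⟩

/-- A function of class `𝒦` takes arbitrarily small positive values. -/
theorem IsClassK.exists_pos_forall_lt {α : ℝ≥0 → ℝ≥0} (h : IsClassK α) {ε : ℝ≥0} (hε : 0 < ε) :
    ∃ δ, 0 < δ ∧ ∀ s ≤ δ, α s < ε := by
  have h1 : ∀ᶠ s in 𝓝 (0 : ℝ≥0), α s < ε :=
    h.continuous.continuousAt.eventually_lt continuousAt_const (by simpa [h.map_zero] using hε)
  have h2 : ∀ᶠ s in 𝓝[>] (0 : ℝ≥0), α s < ε := h1.filter_mono nhdsWithin_le_nhds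
  obtain ⟨δ, hδ, hδ0⟩ := (h2.and self_mem_nhdsWithin).exists
  exact ⟨δ, hδ0, fun s hs => (h.monotone hs).trans_lt hδ⟩

theorem isClassKInf_of_le {α : ℝ≥0 → ℝ≥0} (h : IsClassK α) (hle : ∀ s, s ≤ α s) :
    IsClassKInf α :=
  ⟨h, not_bddAbove_iff.2 fun c => ⟨α (c + 1), ⟨_, rfl⟩, (by simp : c < c + 1).trans_le (hle _)⟩⟩

theorem isClassK_add_id {W : ℝ≥0 → ℝ≥0} (hW : Monotone W) (hc : Continuous W) (h0 : W 0 = 0) :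
    IsClassK fun s => W s + s :=
  ⟨fun _ _ h => add_lt_add_of_le_of_lt (hW h.le) h, hc.add continuous_id, by simp [h0]⟩

/-- A monotone function that is small near zero is continuous there. -/
theorem continuousAt_zero_of_forall_exists {W : ℝ≥0 → ℝ≥0} (hW : Monotone W)
    (h : ∀ ε, 0 < ε → ∃ δ, 0 < δ ∧ W δ ≤ ε) : W 0 = 0 ∧ ContinuousAt W 0 := by
  have h0 : W 0 = 0 := by
    by_contra h0
    obtain ⟨δ, -, hδ⟩ := h (W 0 / 2) (by positivity)
    have := (hW (zero_le (a := δ))).trans hδ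
    exact absurd this (not_le.2 (NNReal.half_lt_self h0))
  refine ⟨h0, ?_⟩
  rw [ContinuousAt, h0]
  refine (nhds_bot_basis (α := ℝ≥0)).tendsto_right_iff.2 fun ε hε => ?_
  obtain ⟨δ, hδ, hδε⟩ := h (ε / 2) (by have : (0:ℝ≥0) < ε := hε; positivity)
  filter_upwards [gt_mem_nhds hδ] with s hs
  exact ((hW (le_of_lt hs)).trans hδε).trans_lt (NNReal.half_lt_self (ne_of_gt hε))

/-- A monotone function that is small near zero is majorized by a function of class `𝒦∞`. -/
theorem exists_isClassKInf_ge {W : ℝ≥0 → ℝ≥0} (hW : Monotone W)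
    (h : ∀ ε, 0 < ε → ∃ δ, 0 < δ ∧ W δ ≤ ε) : ∃ α, IsClassKInf α ∧ ∀ s, W s ≤ α s := by
  obtain ⟨h0, hc⟩ := continuousAt_zero_of_forall_exists hW h
  -- The summand `s` provides strict monotonicity and unboundedness.
  refine ⟨fun s => dyadicAverage W s + s, isClassKInf_of_le (isClassK_add_id
    (monotone_dyadicAverage hW) (continuous_iff_continuousAt.2 fun s =>
      continuousAt_dyadicAverage hW (.inr hc)) ?_) (by simp), fun s =>
      (le_dyadicAverage hW s).trans (by simp)⟩
  simpa [h0] using dyadicAverage_le hW 0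

/-- A bound `b s t`, monotone in `s`, antitone in `t`, vanishing as `t → ∞` and small for small `s`,
is majorized by a function of class `𝒦ℒ`. -/
theorem exists_isClassKL_ge {b : ℝ≥0 → ℝ≥0 → ℝ≥0} (hs : ∀ t, Monotone fun s => b s t)
    (ht : ∀ s, Antitone (b s)) (h : ∀ ε, 0 < ε → ∃ δ, 0 < δ ∧ b δ 0 ≤ ε)
    (hlim : ∀ s ε, 0 < ε → ∃ t, b s t ≤ ε) :
    ∃ β, IsClassKL β ∧ ∀ s t, b s t ≤ β s t := by
  have hb : ∀ t, (b 0 t = 0) ∧ ContinuousAt (fun s => b s t) 0 := fun t =>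
    continuousAt_zero_of_forall_exists (hs t) fun ε hε =>
      let ⟨δ, hδ, hδε⟩ := h ε hε; ⟨δ, hδ, (ht δ zero_le).trans hδε⟩
  have hmono : ∀ t, Monotone (dyadicAverage fun s => b s t) := fun t =>
    monotone_dyadicAverage (hs t)
  have hanti : ∀ s, Antitone fun t => dyadicAverage (fun s => b s t) s := fun s t t' htt' =>
    dyadicAverage_le_dyadicAverage (hs t') (hs t) fun u => ht _ htt'
  -- The term `s / (1 + t)` makes the bound strict in both variables and still vanishes as `t → ∞`.
  refine ⟨fun s t => dyadicAverage (fun s => b s t) s + s / (1 + t), ⟨fun t => ⟨?_, ?_, ?_⟩, ?_, ?_⟩,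
    fun s t => (le_dyadicAverage (hs t) s).trans (by simp)⟩
  · exact fun s s' hss' => add_lt_add_of_le_of_lt (hmono t hss'.le)
      (div_lt_div_of_pos_right hss' (by positivity))
  · exact (continuous_iff_continuousAt.2 fun s =>
      continuousAt_dyadicAverage (hs t) (.inr (hb t).2)).add (continuous_id.div_const _)
  · simpa [(hb t).1] using dyadicAverage_le (hs t) 0
  · exact fun s hs0 t t' htt' => add_lt_add_of_le_of_lt (hanti s htt'.le)
      (div_lt_div_of_pos_left hs0 (by positivity) (by simpa using htt'))
  · intro s
    have h1 : Filter.Tendsto (fun t => dyadicAverage (fun s => b s t) s) Filter.atTop (𝓝 0) := by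
      refine (nhds_bot_basis (α := ℝ≥0)).tendsto_right_iff.2 fun ε hε => ?_
      have hε' : (0 : ℝ≥0) < ε := hε
      obtain ⟨t₀, ht₀⟩ := hlim (s * 2) (ε / 2) (by positivity)
      filter_upwards [Filter.eventually_ge_atTop t₀] with t htt
      exact ((dyadicAverage_le (hs t) s).trans ((ht _ htt).trans ht₀)).trans_lt
        (NNReal.half_lt_self hε'.ne')
    have h2 : Filter.Tendsto (fun t : ℝ≥0 => s / (1 + t)) Filter.atTop (𝓝 0) := by
      rw [← NNReal.tendsto_coe]
      push_cast
      exact Filter.Tendsto.const_div_atTop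
        (Filter.tendsto_atTop_add_const_left _ _ (NNReal.tendsto_coe_atTop.2 Filter.tendsto_id)) _
    simpa using h1.add h2

/-- A monotone function that is positive away from zero dominates, up to the factor `s`, a function
of class `𝒦∞`. -/
theorem exists_isClassKInf_le_mul {g : ℝ≥0 → ℝ≥0} (hg : Monotone g) (hpos : ∀ s, 0 < s → 0 < g s) :
    ∃ α, IsClassKInf α ∧ ∀ s, α s ≤ s * g s := by
  have hm : Monotone fun s => dyadicAverage g (s / 2) := fun s t h =>
    monotone_dyadicAverage hg (div_le_div_of_nonneg_right h zero_le)
  have hp : ∀ s, 0 < s → 0 < dyadicAverage g (s / 2) := fun s hs =>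
    (hpos (s / 2) (by positivity)).trans_le (le_dyadicAverage hg _)
  have hle : ∀ s, dyadicAverage g (s / 2) ≤ g s := fun s => by
    simpa using dyadicAverage_le hg (s / 2)
  -- Averaging over `[s / 2, s]` stays below `g s`. The factor `s` forces the value and limit `0` at
  -- zero even if `g` jumps there, and makes the product strictly increasing and unbounded.
  refine ⟨fun s => s * dyadicAverage g (s / 2), ⟨⟨?_, ?_, by simp⟩, ?_⟩,
    fun s => mul_le_mul_right (hle s) s⟩
  · intro s t hst
    exact mul_lt_mul_of_lt_of_le_of_nonneg_of_pos hst (hm hst.le) zero_le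
      (hp t (zero_le.trans_lt hst))
  · refine continuous_iff_continuousAt.2 fun s => ?_
    by_cases h0 : s = 0
    · subst h0
      have : Filter.Tendsto (fun s : ℝ≥0 => s * dyadicAverage g (s / 2)) (𝓝 0) (𝓝 0) := by
        refine tendsto_of_tendsto_of_tendsto_of_le_of_le' (g := fun _ => (0 : ℝ≥0))
          (h := fun s : ℝ≥0 => s * g 1) tendsto_const_nhds ?_
          (Filter.Eventually.of_forall fun _ => zero_le) ?_
        · simpa using (continuous_mul_const (g 1)).tendsto (0 : ℝ≥0)
        · filter_upwards [gt_mem_nhds (show (0 : ℝ≥0) < 1 by simp)] with s hs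
          exact mul_le_mul_right ((hle s).trans (hg (le_of_lt hs))) s
      simpa [ContinuousAt] using this
    · exact continuousAt_id.mul (ContinuousAt.comp (f := fun s : ℝ≥0 => s / 2)
        (continuousAt_dyadicAverage hg (.inl (by positivity)))
        (continuous_id.div_const _).continuousAt)
  · refine not_bddAbove_iff.2 fun c => ⟨_, ⟨c / dyadicAverage g (1 / 2) + 1, rfl⟩, ?_⟩
    have h1 := hp 1 one_pos
    have h2 := hm (show 1 ≤ c / dyadicAverage g (1 / 2) + 1 by simp)
    calc c < (c / dyadicAverage g (1 / 2) + 1) * dyadicAverage g (1 / 2) := by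
          rw [add_mul, div_mul_cancel₀ _ h1.ne']; simpa using h1
      _ ≤ _ := mul_le_mul_right h2 _

/-- The decay estimate extracted from a Lyapunov inequality with gauges `α₁`, `α₂`, `α₃`. -/
theorem exists_isClassKL_of_lyapunov_gauges {α₁ α₂ α₃ : ℝ≥0 → ℝ≥0} (h₁ : IsClassKInf α₁)
    (h₂ : IsClassKInf α₂) (h₃ : IsClassKInf α₃) :
    ∃ β, IsClassKL β ∧ ∀ s t r, α₁ r ≤ α₂ s → (∀ y, α₂ y ≤ α₁ r → t * α₃ y ≤ α₂ s) →
      r ≤ β s t := by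
  -- All norms `r` compatible with the Lyapunov inequality at time `t` from initial norm `s`; the
  -- supremum serves as the raw bound, and no inverse function is needed.
  set S : ℝ≥0 → ℝ≥0 → Set ℝ≥0 := fun s t =>
    {r | α₁ r ≤ α₂ s ∧ ∀ y, α₂ y ≤ α₁ r → t * α₃ y ≤ α₂ s} with hS
  have hne : ∀ s t, (S s t).Nonempty := fun s t => by
    refine ⟨0, by simp [h₁.1.map_zero], fun y hy => ?_⟩
    have hy0 : y = 0 := by
      by_contra h
      have := h₂.1.pos (pos_iff_ne_zero.2 h)
      rw [h₁.1.map_zero] at hy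
      exact absurd hy (not_le.2 this)
    simp [hy0, h₃.1.map_zero]
  have hbdd : ∀ s t, BddAbove (S s t) := fun s t => by
    obtain ⟨R, hR⟩ := h₁.exists_lt (α₂ s)
    exact ⟨R, fun r hr => (h₁.1.1.lt_iff_lt.1 (hr.1.trans_lt hR)).le⟩
  have hex : ∃ β, IsClassKL β ∧ ∀ s t, sSup (S s t) ≤ β s t := by
    refine exists_isClassKL_ge ?_ ?_ ?_ ?_
    · exact fun t s s' h => csSup_le_csSup (hbdd s' t) (hne s t) fun r hr =>
        ⟨hr.1.trans (h₂.1.monotone h), fun y hy => (hr.2 y hy).trans (h₂.1.monotone h)⟩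
    · exact fun s t t' h => csSup_le_csSup (hbdd s t) (hne s t') fun r hr =>
        ⟨hr.1, fun y hy => (mul_le_mul_left h _).trans (hr.2 y hy)⟩
    · intro ε hε
      obtain ⟨δ, hδ, h⟩ := h₂.1.exists_pos_forall_lt (h₁.1.pos hε)
      exact ⟨δ, hδ, csSup_le (hne _ _) fun r hr =>
        (h₁.1.1.lt_iff_lt.1 (hr.1.trans_lt (h δ le_rfl))).le⟩
    · intro s ε hε
      -- If `r > ε`, this `y` is a lower bound for the norm along the whole path, so the cost `t *
      -- α₃ y` would exceed `α₂ s` at the time chosen below.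
      obtain ⟨y, hy, h⟩ := h₂.1.exists_pos_forall_lt (h₁.1.pos hε)
      have hy3 := h₃.1.pos hy
      refine ⟨α₂ s / α₃ y + 1, csSup_le (hne _ _) fun r hr => ?_⟩
      by_contra! hlt
      have := hr.2 y ((h y le_rfl).le.trans (h₁.1.monotone hlt.le))
      rw [add_mul, div_mul_cancel₀ _ hy3.ne', one_mul] at this
      exact absurd this (not_le.2 (by simpa using hy3))
  obtain ⟨β, hβ, hle⟩ := hex
  exact ⟨β, hβ, fun s t r hr hr' => (le_csSup (hbdd s t) ⟨hr, hr'⟩).trans (hle s t)⟩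

/-! ### Sufficiency of the Lyapunov conditions -/

namespace SampledModel

variable {n q : ℕ} {F : SampledModel n q}

/-- One step from a state dominated by the input stays dominated by the input. -/
theorem exists_isClassKInf_step_le (hc : F.UniformlyContinuousAtOrigin) (hb : F.UniformlyBounded)
    {ρ : ℝ≥0 → ℝ≥0} (hρ : IsClassK ρ) :
    ∃ χ, IsClassKInf χ ∧ ∀ E, ∃ T₁, 0 < T₁ ∧ ∀ x e T, ‖x‖₊ ≤ ρ ‖e‖₊ → ‖e‖₊ ≤ E → 0 < T → T < T₁ →
      ∃ y ∈ F x e T, ‖y‖₊ ≤ χ ‖e‖₊ := by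
  obtain ⟨T₀, hT₀, hc⟩ := hc
  obtain ⟨C, Tc, -, hTc, hC₁, hC₂, hTc₁, hTc₂, hb⟩ := hb
  -- The first alternative, from (iii), makes a bound available for every `r`; the second, from
  -- (ii), makes the infimum small near zero, where `C` need not be.
  set D : ℝ≥0 → Set ℝ≥0 := fun r => {c | C (ρ r) r ≤ c ∨ ∀ x e T, ‖x‖₊ ≤ ρ r → ‖e‖₊ ≤ r →
    0 < T → T < T₀ → ∃ y ∈ F x e T, ‖y‖₊ ≤ c} with hD
  have hne : ∀ r, (D r).Nonempty := fun r => ⟨_, .inl le_rfl⟩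
  have hex : ∃ χ, IsClassKInf χ ∧ ∀ r, sInf (D r) ≤ χ r := by
    refine exists_isClassKInf_ge ?_ ?_
    · refine fun r r' h => csInf_le_csInf (OrderBot.bddBelow _) (hne r') fun c hcD => ?_
      rcases hcD with hcD | hcD
      · exact .inl (((hC₁ r (hρ.monotone h)).trans (hC₂ _ h)).trans hcD)
      · exact .inr fun x e T hx he => hcD x e T (hx.trans (hρ.monotone h)) (he.trans h)
    · intro ε hε
      obtain ⟨δ, hδ, h⟩ := hc ε hε
      obtain ⟨η, hη, hηδ⟩ := hρ.exists_pos_forall_lt hδ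
      refine ⟨min δ η, lt_min hδ hη, csInf_le (OrderBot.bddBelow _) (.inr fun x e T hx he hT hTT => ?_)⟩
      obtain ⟨y, hy, hyε⟩ := h x e T (hx.trans (hηδ _ (min_le_right _ _)).le)
        (he.trans (min_le_left _ _)) hT hTT
      exact ⟨y, hy, hyε.le⟩
  obtain ⟨χ, hχ, hle⟩ := hex
  refine ⟨χ, hχ, fun E => ⟨min T₀ (Tc (ρ E) E), lt_min hT₀ (hTc _ _), fun x e T hx he hT hTT => ?_⟩⟩
  -- Antitonicity of `Tc` lets one threshold for `E` serve the bound taken at the actual size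
  -- `‖e‖₊`.
  have hTe : T < Tc (ρ ‖e‖₊) ‖e‖₊ := (hTT.trans_le (min_le_right _ _)).trans_le
    ((hTc₁ E (hρ.monotone he)).trans (hTc₂ _ he))
  obtain ⟨y, hy, hyC⟩ := hb _ _ x e T hx le_rfl hT hTe
  refine ⟨y, hy, (le_csInf (hne _) fun c hcD => ?_).trans (hle _)⟩
  rcases hcD with hcD | hcD
  · exact hyC.trans hcD
  · obtain ⟨z, hz, hzc⟩ := hcD x e T hx le_rfl hT (hTT.trans_le (min_le_left _ _))
    rwa [Part.mem_unique hy hz]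

/-- Along a sequence whose steps either decrease `V` or land in the region dominated by the input,
the state obeys the input-to-state bound. -/
theorem norm_le_of_lyapunov_steps {α₁ α₂ α₃ χ : ℝ≥0 → ℝ≥0} (h₂ : IsClassKInf α₂)
    (h₃ : IsClassKInf α₃) (hχ : IsClassKInf χ) {β : ℝ≥0 → ℝ≥0 → ℝ≥0}
    (hβ : ∀ s t r, α₁ r ≤ α₂ s → (∀ y, α₂ y ≤ α₁ r → t * α₃ y ≤ α₂ s) → r ≤ β s t)
    {V : EuclideanSpace ℝ (Fin n) → ℝ≥0∞} (hV₁ : ∀ x, (α₁ ‖x‖₊ : ℝ≥0∞) ≤ V x)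
    {x : ℕ → EuclideanSpace ℝ (Fin n)} {e : ℕ → EuclideanSpace ℝ (Fin q)} {T : ℕ → ℝ≥0}
    (hV₂ : ∀ k, V (x k) ≤ (α₂ ‖x k‖₊ : ℝ≥0∞))
    (hstep : ∀ k, V (x (k + 1)) + (T k * α₃ ‖x k‖₊ : ℝ≥0) ≤ V (x k) ∨ ‖x (k + 1)‖₊ ≤ χ ‖e k‖₊)
    (k : ℕ) :
    ‖x k‖₊ ≤ β ‖x 0‖₊ (∑ i ∈ Finset.range k, T i) ∨
      ‖x k‖₊ ≤ β (χ ((Finset.range k).sup fun i => ‖e i‖₊)) 0 := by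
  -- The second alternative persists: a later step either does not increase `V` or lands again in
  -- the region dominated by the input.
  have key : ∀ k, (V (x k) + ((∑ i ∈ Finset.range k, T i * α₃ ‖x i‖₊ : ℝ≥0) : ℝ≥0∞) ≤ V (x 0) ∧
        ∀ i < k, V (x k) ≤ V (x i)) ∨
      V (x k) ≤ (α₂ (χ ((Finset.range k).sup fun i => ‖e i‖₊)) : ℝ≥0∞) := by
    intro k
    induction k with
    | zero => exact .inl ⟨by simp, by simp⟩
    | succ k ih =>
      have hmono : (Finset.range k).sup (fun i => ‖e i‖₊) ≤
          (Finset.range (k + 1)).sup fun i => ‖e i‖₊ :=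
        Finset.sup_mono (Finset.range_mono (Nat.le_succ k))
      rcases hstep k with h | h
      · have hle : V (x (k + 1)) ≤ V (x k) := le_self_add.trans h
        rcases ih with ⟨ih₁, ih₂⟩ | ih
        · refine .inl ⟨?_, fun i hi => ?_⟩
          · rw [Finset.sum_range_succ, add_comm (∑ i ∈ Finset.range k, _), ENNReal.coe_add,
              ← add_assoc]
            exact (add_le_add_left h _).trans ih₁
          · rcases Nat.lt_succ_iff_lt_or_eq.1 hi with hi | rfl
            · exact hle.trans (ih₂ i hi)
            · exact hle
        · exact .inr (hle.trans (ih.trans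
            (ENNReal.coe_le_coe.2 (h₂.1.monotone (hχ.1.monotone hmono)))))
      · refine .inr ((hV₂ _).trans (ENNReal.coe_le_coe.2 (h₂.1.monotone (h.trans
          (hχ.1.monotone ?_)))))
        exact Finset.le_sup (f := fun i => ‖e i‖₊) (Finset.self_mem_range_succ k)
  rcases key k with ⟨h, h'⟩ | h
  · refine .inl (hβ _ _ _ ?_ fun y hy => ?_)
    · exact ENNReal.coe_le_coe.1 ((hV₁ _).trans ((le_self_add.trans h).trans (hV₂ 0)))
    · have hsum : ∑ i ∈ Finset.range k, T i * α₃ ‖x i‖₊ ≤ α₂ ‖x 0‖₊ :=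
        ENNReal.coe_le_coe.1 ((le_add_self.trans h).trans (hV₂ 0))
      rw [Finset.sum_mul]
      refine (Finset.sum_le_sum fun i hi => mul_le_mul_right (h₃.1.monotone ?_) _).trans hsum
      refine h₂.1.1.le_iff_le.1 (ENNReal.coe_le_coe.1 ?_)
      exact (ENNReal.coe_le_coe.2 hy).trans ((hV₁ _).trans ((h' i (Finset.mem_range.1 hi)).trans
        (hV₂ i)))
  -- Time `0` makes the accumulated-cost condition vacuous; `χ` of the input supremum acts as the
  -- initial norm.
  · exact .inr (hβ _ _ _ (ENNReal.coe_le_coe.1 ((hV₁ _).trans h)) (by simp))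

/-- The set `V ≤ α₂ D` contains all admitted initial states and all states dominated by the input,
and lies in the ball of radius `R`. Taking `V` for the radius `max R D` makes it invariant, so
solutions exist for all times. -/
theorem isSISSVSR_of_hasLyapunovFamily (hc : F.UniformlyContinuousAtOrigin)
    (hb : F.UniformlyBounded) (hL : F.HasLyapunovFamily) : F.IsSISSVSR := by
  obtain ⟨α₁, α₂, α₃, ρ, h₁, h₂, h₃, hρ, hL⟩ := hL
  obtain ⟨χ, hχ, hstep⟩ := exists_isClassKInf_step_le hc hb hρ
  obtain ⟨β, hβ, hdecay⟩ := exists_isClassKL_of_lyapunov_gauges h₁ h₂ h₃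
  refine ⟨β, fun r => β (χ r) 0 + r, hβ, isClassKInf_of_le (isClassK_add_id
    ((hβ.1 0).monotone.comp hχ.1.monotone) ((hβ.1 0).continuous.comp hχ.1.continuous)
    (by simp [hχ.1.map_zero, (hβ.1 0).map_zero])) (by simp), fun M E => ?_⟩
  set D := max M (χ E) with hD
  obtain ⟨R, hR⟩ := h₁.exists_lt (α₂ D)
  obtain ⟨T₁, hT₁, hstep⟩ := hstep E
  obtain ⟨T₂, hT₂, V, hV₁, hV₂, hV₃⟩ := hL (max R D) E
  refine ⟨min T₁ T₂, lt_min hT₁ hT₂, fun T hT ξ hξ e he => ?_⟩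
  have hnorm : ∀ x, V x ≤ (α₂ D : ℝ≥0∞) → ‖x‖₊ ≤ max R D := fun x hx =>
    (h₁.1.1.lt_iff_lt.1 ((ENNReal.coe_le_coe.1 ((hV₁ x).trans hx)).trans_lt hR)).le.trans
      (le_max_left _ _)
  have hnext : ∀ (k : ℕ) (x : {x // V x ≤ (α₂ D : ℝ≥0∞)}),
      ∃ y : {x // V x ≤ (α₂ D : ℝ≥0∞)}, (y : EuclideanSpace ℝ (Fin n)) ∈ F x (e k) (T k) ∧
        (V y + (T k * α₃ ‖(x : EuclideanSpace ℝ (Fin n))‖₊ : ℝ≥0) ≤ V x ∨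
          ‖(y : EuclideanSpace ℝ (Fin n))‖₊ ≤ χ ‖e k‖₊) := by
    rintro k ⟨x, hx⟩
    rcases le_total (ρ ‖e k‖₊) ‖x‖₊ with h | h
    · obtain ⟨y, hy, hyV⟩ := hV₃ x (e k) (T k) h (hnorm x hx) (he k) (hT k).1
        ((hT k).2.trans_le (min_le_right _ _))
      exact ⟨⟨y, (le_self_add.trans hyV).trans hx⟩, hy, .inl hyV⟩
    · obtain ⟨y, hy, hyχ⟩ := hstep x (e k) (T k) h (he k) (hT k).1
        ((hT k).2.trans_le (min_le_left _ _))
      have hyD : ‖y‖₊ ≤ D := hyχ.trans ((hχ.1.monotone (he k)).trans (le_max_right _ _))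
      exact ⟨⟨y, (hV₂ y (hyD.trans (le_max_right _ _))).trans
        (ENNReal.coe_le_coe.2 (h₂.1.monotone hyD))⟩, hy, .inr hyχ⟩
  choose next hnext₁ hnext₂ using hnext
  have hξD : ‖ξ‖₊ ≤ D := hξ.trans (le_max_left _ _)
  have hξV : V ξ ≤ (α₂ D : ℝ≥0∞) :=
    (hV₂ ξ (hξD.trans (le_max_right _ _))).trans (ENNReal.coe_le_coe.2 (h₂.1.monotone hξD))
  obtain ⟨z, hz₀, hz⟩ : ∃ z : ℕ → {x // V x ≤ (α₂ D : ℝ≥0∞)},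
      z 0 = ⟨ξ, hξV⟩ ∧ ∀ k, z (k + 1) = next k (z k) :=
    ⟨fun k => Nat.rec ⟨ξ, hξV⟩ next k, rfl, fun _ => rfl⟩
  have hz₀' : (z 0).1 = ξ := by rw [hz₀]
  have hsol : F.IsSolution ξ e T (fun k => (z k).1) :=
    ⟨hz₀', fun k => by simpa only [hz k] using hnext₁ k (z k)⟩
  have hlyap : ∀ k, V (z (k + 1)).1 + (T k * α₃ ‖(z k).1‖₊ : ℝ≥0) ≤ V (z k).1 ∨
      ‖(z (k + 1)).1‖₊ ≤ χ ‖e k‖₊ := fun k => by rw [hz k]; exact hnext₂ k (z k)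
  refine ⟨_, hsol, fun k => ?_⟩
  rw [← hz₀']
  rcases norm_le_of_lyapunov_steps (x := fun k => (z k).1) h₂ h₃ hχ hdecay
    hV₁ (fun k => hV₂ _ (hnorm _ (z k).2)) hlyap k with h | h
  · exact h.trans le_self_add
  · exact h.trans (le_self_add.trans le_add_self)

end SampledModel

/-! ### Settling times and the cost gauge -/

/-- A time after which `β a` is at most `b`, monotone in `a` and antitone in `b`. -/
noncomputable def settlingTime (β : ℝ≥0 → ℝ≥0 → ℝ≥0) (a b : ℝ≥0) : ℝ≥0 :=
  sInf {t | β a t ≤ b} + 1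

namespace IsClassKL

variable {β : ℝ≥0 → ℝ≥0 → ℝ≥0}

theorem antitone (hβ : IsClassKL β) (s : ℝ≥0) : Antitone (β s) := by
  rcases eq_or_lt_of_le (zero_le (a := s)) with rfl | hs
  · intro t t' _
    simp [(hβ.1 t).map_zero, (hβ.1 t').map_zero]
  · exact (hβ.2.1 s hs).antitone

theorem exists_le (hβ : IsClassKL β) (a : ℝ≥0) {b : ℝ≥0} (hb : 0 < b) :
    {t | β a t ≤ b}.Nonempty :=
  ((hβ.2.2 a).eventually (ge_mem_nhds hb)).exists

theorem settlingTime_spec (hβ : IsClassKL β) (a : ℝ≥0) {b : ℝ≥0} (hb : 0 < b) :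
    β a (settlingTime β a b) ≤ b := by
  obtain ⟨t, ht, hlt⟩ := exists_lt_of_csInf_lt (hβ.exists_le a hb)
    (show sInf {t | β a t ≤ b} < settlingTime β a b by simp [settlingTime])
  exact (hβ.antitone a hlt.le).trans ht

theorem settlingTime_mono (hβ : IsClassKL β) {a a' b b' : ℝ≥0} (ha : a ≤ a') (hb : 0 < b')
    (hbb : b' ≤ b) : settlingTime β a b ≤ settlingTime β a' b' :=
  add_le_add_left (csInf_le_csInf (OrderBot.bddBelow _) (hβ.exists_le a' hb) fun t ht =>
    ((hβ.1 t).monotone ha).trans (le_trans ht hbb)) 1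

theorem isClassKInf_add_id (hβ : IsClassKL β) : IsClassKInf fun s => β s 0 + s :=
  isClassKInf_of_le (isClassK_add_id (hβ.1 0).monotone (hβ.1 0).continuous (hβ.1 0).map_zero)
    (by simp)

/-- A gauge `α` so flat near zero that the cost of reaching half of the initial level, measured
with `α`, is at most linear for small initial levels. -/
theorem exists_cost_gauge (hβ : IsClassKL β) : ∃ α m, IsClassKInf α ∧ Monotone m ∧
    ∀ s, 0 < s → ∃ τ, β s τ ≤ s / 4 ∧ (τ + 1) * α (β s 0 + s) ≤ s * m s := by
  have hκ := hβ.isClassKInf_add_id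
  set κ : ℝ≥0 → ℝ≥0 := fun s => β s 0 + s with hκdef
  -- The settling time starts from the fixed level `1`, an upper bound for small `s`, so that `f` is
  -- monotone.
  set f : ℝ≥0 → ℝ≥0 := fun s => s / (settlingTime β 1 (s / 4) + 1) with hf
  have hfpos : ∀ s, 0 < s → 0 < f s := fun s hs => div_pos hs (by positivity)
  have hfmono : Monotone f := by
    intro s s' h
    rcases eq_or_lt_of_le (zero_le (a := s)) with rfl | hs
    · simp [hf]
    · exact div_le_div₀ zero_le h (by positivity) (add_le_add_left (hβ.settlingTime_mono le_rfl
        (by positivity) (div_le_div_of_nonneg_right h zero_le)) 1)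
  -- A generalized `f ∘ κ⁻¹`: the gauge `α y ≤ y * g y` then satisfies `α (κ s) ≤ κ s * f s`, which
  -- cancels the settling time.
  set g : ℝ≥0 → ℝ≥0 := fun y => sInf (f '' {s | y ≤ κ s}) with hg
  have hne : ∀ y, (f '' {s | y ≤ κ s}).Nonempty := fun y => ⟨f y, y, by simp [hκdef], rfl⟩
  have hgmono : Monotone g := fun y y' h => csInf_le_csInf (OrderBot.bddBelow _) (hne y')
    (Set.image_mono fun s hs => le_trans h hs)
  have hgle : ∀ s, g (κ s) ≤ f s := fun s =>
    csInf_le (OrderBot.bddBelow _) ⟨s, le_refl (κ s), rfl⟩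
  have hgpos : ∀ y, 0 < y → 0 < g y := by
    intro y hy
    obtain ⟨δ, hδ, h⟩ := hκ.1.exists_pos_forall_lt hy
    refine (hfpos δ hδ).trans_le (le_csInf (hne y) ?_)
    rintro _ ⟨s, hs, rfl⟩
    exact hfmono (hκ.1.1.lt_iff_lt.1 ((h δ le_rfl).trans_le hs)).le
  obtain ⟨α, hα, hαg⟩ := exists_isClassKInf_le_mul hgmono hgpos
  refine ⟨α, fun s => κ s + (settlingTime β s (1 / 4) + 1) * α (κ s), hα, ?_, fun s hs => ?_⟩
  · intro s s' h
    exact add_le_add (hκ.1.monotone h) (mul_le_mul' (add_le_add_left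
      (hβ.settlingTime_mono h (by positivity) le_rfl) 1) (hα.1.monotone (hκ.1.monotone h)))
  -- Flatness matters only for `s ≤ 1`; for `s ≥ 1` the second summand of `m` already contains the
  -- whole cost.
  · rcases le_total s 1 with h1 | h1
    · refine ⟨settlingTime β 1 (s / 4), ((hβ.1 _).monotone h1).trans
        (hβ.settlingTime_spec 1 (by positivity)), ?_⟩
      have hpos : 0 < settlingTime β 1 (s / 4) + 1 := by positivity
      calc (settlingTime β 1 (s / 4) + 1) * α (κ s)
          ≤ (settlingTime β 1 (s / 4) + 1) * (κ s * f s) :=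
            mul_le_mul_right ((hαg _).trans (mul_le_mul_right (hgle s) _)) _
        _ = s * κ s := by simp only [hf]; field_simp
        _ ≤ _ := mul_le_mul_right le_self_add _
    · refine ⟨settlingTime β s (1 / 4), (hβ.settlingTime_spec s (by positivity)).trans
        (div_le_div_of_nonneg_right h1 zero_le), ?_⟩
      exact (le_add_self (b := κ s)).trans (le_mul_of_one_le_left zero_le h1)

end IsClassKL

/-! ### Admissible trajectories and their worst cost -/

namespace SampledModel

variable {n q : ℕ} {F : SampledModel n q}

/-- The first `k` steps of `x` follow the model, with inputs that are small relative to the state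
as measured by `ρ`. -/
def IsAdmissible (F : SampledModel n q) (ρ : ℝ≥0 → ℝ≥0) (E T₀ : ℝ≥0)
    (x : ℕ → EuclideanSpace ℝ (Fin n)) (e : ℕ → EuclideanSpace ℝ (Fin q)) (T : ℕ → ℝ≥0)
    (k : ℕ) : Prop :=
  (∀ i, ‖e i‖₊ ≤ E) ∧ (∀ i, 0 < T i ∧ T i < T₀) ∧
    ∀ i < k, x (i + 1) ∈ F (x i) (e i) (T i) ∧ ρ ‖e i‖₊ ≤ ‖x i‖₊

/-- The worst final norm plus accumulated cost over all admissible finite trajectories. -/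
noncomputable def worstCost (F : SampledModel n q) (ρ α : ℝ≥0 → ℝ≥0) (E T₀ : ℝ≥0)
    (ξ : EuclideanSpace ℝ (Fin n)) : ℝ≥0∞ :=
  ⨆ (x : ℕ → EuclideanSpace ℝ (Fin n)) (e : ℕ → EuclideanSpace ℝ (Fin q)) (T : ℕ → ℝ≥0) (k : ℕ)
    (_ : x 0 = ξ ∧ F.IsAdmissible ρ E T₀ x e T k),
    ((‖x k‖₊ + ∑ i ∈ Finset.range k, T i * α ‖x i‖₊ : ℝ≥0) : ℝ≥0∞)

section

variable {ρ α : ℝ≥0 → ℝ≥0} {E T₀ : ℝ≥0} {x : ℕ → EuclideanSpace ℝ (Fin n)}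
  {e : ℕ → EuclideanSpace ℝ (Fin q)} {T : ℕ → ℝ≥0} {k : ℕ}

theorem IsAdmissible.le_worstCost (h : F.IsAdmissible ρ E T₀ x e T k) :
    ((‖x k‖₊ + ∑ i ∈ Finset.range k, T i * α ‖x i‖₊ : ℝ≥0) : ℝ≥0∞) ≤ F.worstCost ρ α E T₀ (x 0) :=
  le_iSup_of_le x (le_iSup_of_le e (le_iSup_of_le T (le_iSup_of_le k
    (le_iSup_of_le ⟨rfl, h⟩ le_rfl))))

theorem IsAdmissible.shift {j l : ℕ} (h : F.IsAdmissible ρ E T₀ x e T (j + l)) :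
    F.IsAdmissible ρ E T₀ (fun i => x (j + i)) (fun i => e (j + i)) (fun i => T (j + i)) l :=
  ⟨fun _ => h.1 _, fun _ => h.2.1 _, fun i hi => h.2.2 (j + i) (by omega)⟩

theorem isAdmissible_zero (hT₀ : 0 < T₀) (ξ : EuclideanSpace ℝ (Fin n)) :
    F.IsAdmissible ρ E T₀ (fun _ => ξ) (fun _ => 0) (fun _ => T₀ / 2) 0 :=
  ⟨by simp, fun _ => ⟨by positivity, NNReal.half_lt_self hT₀.ne'⟩, by simp⟩

theorem nnnorm_le_worstCost (hT₀ : 0 < T₀) (ξ : EuclideanSpace ℝ (Fin n)) :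
    (‖ξ‖₊ : ℝ≥0∞) ≤ F.worstCost ρ α E T₀ ξ := by
  simpa using (isAdmissible_zero hT₀ ξ).le_worstCost (α := α)

/-- Prepending an admissible step to a trajectory. -/
theorem worstCost_add_le {ξ y : EuclideanSpace ℝ (Fin n)} {e₀ : EuclideanSpace ℝ (Fin q)}
    {t : ℝ≥0} (hy : y ∈ F ξ e₀ t) (hρ : ρ ‖e₀‖₊ ≤ ‖ξ‖₊) (he : ‖e₀‖₊ ≤ E) (ht : 0 < t)
    (htT : t < T₀) :
    F.worstCost ρ α E T₀ y + (t * α ‖ξ‖₊ : ℝ≥0) ≤ F.worstCost ρ α E T₀ ξ := by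
  have key : ∀ x e T k, x 0 = y → F.IsAdmissible ρ E T₀ x e T k →
      ((‖x k‖₊ + ∑ i ∈ Finset.range k, T i * α ‖x i‖₊ : ℝ≥0) : ℝ≥0∞) + (t * α ‖ξ‖₊ : ℝ≥0) ≤
        F.worstCost ρ α E T₀ ξ := by
    rintro x e T k rfl h
    have h' : F.IsAdmissible ρ E T₀ (fun i => Nat.casesOn i ξ x) (fun i => Nat.casesOn i e₀ e)
        (fun i => Nat.casesOn i t T) (k + 1) := by
      refine ⟨fun i => ?_, fun i => ?_, fun i hi => ?_⟩
      · cases i with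
        | zero => exact he
        | succ i => exact h.1 i
      · cases i with
        | zero => exact ⟨ht, htT⟩
        | succ i => exact h.2.1 i
      · cases i with
        | zero => exact ⟨hy, hρ⟩
        | succ i => exact h.2.2 i (by omega)
    refine le_of_eq_of_le ?_ (h'.le_worstCost (α := α))
    rw [Finset.sum_range_succ', ← add_assoc]
    exact (ENNReal.coe_add _ _).symm
  -- The finite step cost is moved across so that the supremum can be bounded term by term.
  have hle : F.worstCost ρ α E T₀ y ≤ F.worstCost ρ α E T₀ ξ - (t * α ‖ξ‖₊ : ℝ≥0) :=
    iSup_le fun x => iSup_le fun e => iSup_le fun T => iSup_le fun k => iSup_le fun h =>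
      ENNReal.le_sub_of_add_le_right ENNReal.coe_ne_top (key x e T k h.1 h.2)
  exact (add_le_add_left hle _).trans (tsub_add_cancel_of_le (le_add_self.trans
    (key _ _ _ 0 rfl (isAdmissible_zero (ht.trans htT) y)))).le

/-- An input-to-state estimate along admissible trajectories of length `k` yields decay without
input terms. -/
theorem IsAdmissible.nnnorm_le {β : ℝ≥0 → ℝ≥0 → ℝ≥0} {γ : ℝ≥0 → ℝ≥0} (hβ : IsClassKL β)
    (hγ : IsClassKInf γ)
    (h : F.IsAdmissible (fun r => β (4 * γ r) 0 + 4 * γ r) E T₀ x e T k)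
    (hiss : ∀ i ≤ k, ‖x i‖₊ ≤ β ‖x 0‖₊ (∑ j ∈ Finset.range i, T j) +
      γ ((Finset.range i).sup fun j => ‖e j‖₊)) :
    ∀ i ≤ k, ‖x i‖₊ ≤ β ‖x 0‖₊ (∑ j ∈ Finset.range i, T j) + ‖x 0‖₊ / 4 := by
  intro i
  induction i using Nat.strong_induction_on with
  | _ i ih =>
    intro hi
    refine (hiss i hi).trans (add_le_add_right ?_ _)
    rcases Nat.eq_zero_or_pos i with rfl | hpos
    · simp [hγ.1.map_zero]
    obtain ⟨j, hj, hsup⟩ := Finset.exists_mem_eq_sup (Finset.range i) ⟨0, by simpa using hpos⟩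
      fun j => ‖e j‖₊
    rw [hsup]
    have hj := Finset.mem_range.1 hj
    -- With `κ s = β s 0 + s`, admissibility and the induction hypothesis read `κ (4 γ |e_j|) ≤
    -- |x_j| ≤ κ |x_0|`; cancelling `κ` gives `γ |e_j| ≤ |x_0| / 4`.
    have h1 : β (4 * γ ‖e j‖₊) 0 + 4 * γ ‖e j‖₊ ≤ β ‖x 0‖₊ 0 + ‖x 0‖₊ :=
      (h.2.2 j (hj.trans_le hi)).2.trans ((ih j hj (hj.le.trans hi)).trans
        (add_le_add (hβ.antitone _ zero_le) (NNReal.div_le_of_le_mul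
          (le_mul_of_one_le_right zero_le (by norm_num)))))
    have h2 : 4 * γ ‖e j‖₊ ≤ ‖x 0‖₊ := hβ.isClassKInf_add_id.1.1.le_iff_le.1 h1
    rwa [le_div_iff₀ (by positivity), mul_comm]

/-- Decay along all admissible trajectories bounds their accumulated cost. -/
theorem sum_cost_le {β : ℝ≥0 → ℝ≥0 → ℝ≥0} (hβ : IsClassKL β) {m : ℝ≥0 → ℝ≥0} (hα : IsClassKInf α)
    (hm : Monotone m)
    (hτ : ∀ s, 0 < s → ∃ τ, β s τ ≤ s / 4 ∧ (τ + 1) * α (β s 0 + s) ≤ s * m s) {M : ℝ≥0}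
    (hT₀ : T₀ ≤ 1)
    (hdecay : ∀ x e T k, ‖x 0‖₊ ≤ M → F.IsAdmissible ρ E T₀ x e T k → ∀ i ≤ k,
      ‖x i‖₊ ≤ β ‖x 0‖₊ (∑ j ∈ Finset.range i, T j) + ‖x 0‖₊ / 4) (hx : ‖x 0‖₊ ≤ M)
    (h : F.IsAdmissible ρ E T₀ x e T k) :
    ∑ i ∈ Finset.range k, T i * α ‖x i‖₊ ≤ 2 * (‖x 0‖₊ * m ‖x 0‖₊) := by
  induction k using Nat.strong_induction_on generalizing x e T with
  | _ k ih =>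
    have hd := hdecay x e T k hx h
    set s := ‖x 0‖₊ with hs
    rcases eq_or_lt_of_le (zero_le (a := s)) with hs0 | hs0
    · refine le_of_eq_of_le (Finset.sum_eq_zero fun i hi => ?_) zero_le
      have := hd i (Finset.mem_range.1 hi).le
      rw [← hs0, (hβ.1 _).map_zero] at this
      have h0 : ‖x i‖₊ = 0 := by simpa using this
      simp [h0, hα.1.map_zero]
    obtain ⟨τ, hτ₁, hτ₂⟩ := hτ s hs0
    have hex : ∃ j, j ≥ k ∨ ‖x j‖₊ ≤ s / 2 := ⟨k, .inl le_rfl⟩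
    classical
    -- `j` is the first index where the norm is at most `s / 2`, or `k` if there is none earlier.
    -- Before `j` at most time `τ` has elapsed, since afterwards the norm is at most `s / 4 + s /
    -- 4`.
    obtain ⟨j, hj, hmin⟩ : ∃ j, (j ≥ k ∨ ‖x j‖₊ ≤ s / 2) ∧ ∀ i < j, i < k ∧ s / 2 < ‖x i‖₊ :=
      ⟨Nat.find hex, Nat.find_spec hex, fun i hi => by simpa using Nat.find_min hex hi⟩
    have hjk : j ≤ k := by
      by_contra! hlt
      exact lt_irrefl _ (hmin k hlt).1
    have htime : ∀ i < j, ∑ l ∈ Finset.range i, T l ≤ τ := by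
      intro i hi
      by_contra! hlt
      have h1 := (hd i (hmin i hi).1.le).trans
        (add_le_add_left ((hβ.antitone s hlt.le).trans hτ₁) _)
      have h2 : s / 4 + s / 4 = s / 2 := by ring
      exact absurd (hmin i hi).2 (not_lt.2 (h2 ▸ h1))
    -- The last step may overshoot `τ`, but by at most `T₀ ≤ 1`; hence the `τ + 1` in the gauge.
    have htime' : ∑ l ∈ Finset.range j, T l ≤ τ + 1 := by
      rcases j with _ | i
      · simp
      · rw [Finset.sum_range_succ]
        exact add_le_add (htime i (by simp)) ((h.2.1 i).2.le.trans hT₀)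
    have hstage : ∑ i ∈ Finset.range j, T i * α ‖x i‖₊ ≤ s * m s := by
      refine le_trans ?_ hτ₂
      refine le_trans ?_ (mul_le_mul_left htime' _)
      rw [Finset.sum_mul]
      refine Finset.sum_le_sum fun i hi => mul_le_mul_right (hα.1.monotone ?_) _
      exact (hd i (hmin i (Finset.mem_range.1 hi)).1.le).trans
        (add_le_add (hβ.antitone _ zero_le) (NNReal.div_le_of_le_mul
          (le_mul_of_one_le_right zero_le (by norm_num))))
    rcases hj with hj | hj
    · obtain rfl : j = k := le_antisymm hjk hj
      exact hstage.trans (le_mul_of_one_le_left zero_le (by norm_num))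
    · obtain ⟨l, rfl⟩ := Nat.exists_eq_add_of_le hjk
      have hj0 : 0 < j := by
        rcases Nat.eq_zero_or_pos j with rfl | hj0
        · exact absurd hj (not_le.2 (NNReal.half_lt_self hs0.ne'))
        · exact hj0
      have hjs : ‖x j‖₊ ≤ s := hj.trans (NNReal.half_le_self s)
      have hrest := ih l (by omega) (x := fun i => x (j + i)) (hjs.trans hx) h.shift
      rw [Finset.sum_range_add, two_mul]
      refine add_le_add hstage (hrest.trans ?_)
      -- The restart from level at most `s / 2` costs no more than the first stage bound, which
      -- closes the geometric sum.
      calc 2 * (‖x j‖₊ * m ‖x j‖₊) ≤ 2 * (s / 2 * m s) :=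
            mul_le_mul_right (mul_le_mul' hj (hm hjs)) _
        _ = s * m s := by ring

end

/-! ### Necessity of the four conditions -/

theorem IsSISSVSR.zeroAtOrigin (h : F.IsSISSVSR) : F.ZeroAtOrigin := by
  obtain ⟨β, γ, hβ, hγ, h⟩ := h
  obtain ⟨T₀, hT₀, h⟩ := h 0 0
  refine ⟨T₀, hT₀, fun T hT hTT => ?_⟩
  obtain ⟨x, hx, hle⟩ := h (fun _ => T) (fun _ => ⟨hT, hTT⟩) 0 (by simp) (fun _ => 0) (by simp)
  have h1 := hle 1
  have h2 := hx.2 0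
  rw [hx.1] at h2
  have h3 : x 1 = 0 := by simpa [(hβ.1 _).map_zero, hγ.1.map_zero] using h1
  rwa [zero_add, h3] at h2

/-- The one-step estimate contained in input-to-state stability. -/
theorem IsSISSVSR.exists_step_le (h : F.IsSISSVSR) : ∃ β γ : ℝ≥0 → ℝ≥0, IsClassK β ∧ IsClassK γ ∧
    ∀ M E, ∃ T₀, 0 < T₀ ∧ ∀ x e T, ‖x‖₊ ≤ M → ‖e‖₊ ≤ E → 0 < T → T < T₀ →
      ∃ y ∈ F x e T, ‖y‖₊ ≤ β ‖x‖₊ + γ ‖e‖₊ := by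
  obtain ⟨β, γ, hβ, hγ, h⟩ := h
  refine ⟨fun s => β s 0, γ, hβ.1 0, hγ.1, fun M E => ?_⟩
  obtain ⟨T₀, hT₀, h⟩ := h M E
  refine ⟨T₀, hT₀, fun x e T hx he hT hTT => ?_⟩
  obtain ⟨z, hz, hle⟩ := h (fun _ => T) (fun _ => ⟨hT, hTT⟩) x hx (fun _ => e) (fun _ => he)
  have h2 := hz.2 0
  rw [hz.1] at h2
  refine ⟨_, h2, (hle 1).trans (add_le_add (hβ.antitone _ zero_le) ?_)⟩
  simp

theorem IsSISSVSR.uniformlyContinuousAtOrigin (h : F.IsSISSVSR) :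
    F.UniformlyContinuousAtOrigin := by
  obtain ⟨β, γ, hβ, hγ, h⟩ := h.exists_step_le
  obtain ⟨T₀, hT₀, h⟩ := h 1 1
  refine ⟨T₀, hT₀, fun ε hε => ?_⟩
  obtain ⟨δ₁, hδ₁, h₁⟩ := hβ.exists_pos_forall_lt (half_pos hε)
  obtain ⟨δ₂, hδ₂, h₂⟩ := hγ.exists_pos_forall_lt (half_pos hε)
  refine ⟨min 1 (min δ₁ δ₂), by positivity, fun x e T hx he hT hTT => ?_⟩
  obtain ⟨y, hy, hle⟩ := h x e T (hx.trans (min_le_left _ _)) (he.trans (min_le_left _ _)) hT hTT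
  refine ⟨y, hy, hle.trans_lt ?_⟩
  rw [← add_halves ε]
  exact add_lt_add (h₁ _ (hx.trans ((min_le_right _ _).trans (min_le_left _ _))))
    (h₂ _ (he.trans ((min_le_right _ _).trans (min_le_right _ _))))

theorem IsSISSVSR.uniformlyBounded (h : F.IsSISSVSR) : F.UniformlyBounded := by
  obtain ⟨β, γ, hβ, hγ, h⟩ := h.exists_step_le
  choose T₀ hT₀ h using h
  -- The given thresholds `T₀ M E` need not be monotone; their minimum over integer pairs up to
  -- `(⌈M⌉, ⌈E⌉)` is antitone and positive.
  refine ⟨fun M E => β M + γ E + 1, fun M E => (Finset.range (⌈M⌉₊ + 1)).inf'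
    Finset.nonempty_range_add_one fun i => (Finset.range (⌈E⌉₊ + 1)).inf'
      Finset.nonempty_range_add_one fun j => T₀ i j, fun M E => by positivity, fun M E => ?_,
      fun E M M' hM => ?_, fun M E E' hE => ?_, fun E M M' hM => ?_, fun M E E' hE => ?_,
      fun M E x e T hx he hT hTT => ?_⟩
  · simp only [Finset.lt_inf'_iff]
    exact fun _ _ _ _ => hT₀ _ _
  · exact add_le_add_left (add_le_add_left (hβ.monotone hM) _) _
  · exact add_le_add_left (add_le_add_right (hγ.monotone hE) _) _
  · exact Finset.inf'_mono _ (Finset.range_mono (Nat.succ_le_succ (Nat.ceil_mono hM))) _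
  · exact Finset.inf'_mono_fun fun i _ =>
      Finset.inf'_mono _ (Finset.range_mono (Nat.succ_le_succ (Nat.ceil_mono hE))) _
  · simp only [Finset.lt_inf'_iff] at hTT
    obtain ⟨y, hy, hle⟩ := h _ _ x e T (hx.trans (Nat.le_ceil M)) (he.trans (Nat.le_ceil E)) hT
      (hTT _ (Finset.self_mem_range_succ _) _ (Finset.self_mem_range_succ _))
    exact ⟨y, hy, hle.trans ((add_le_add (hβ.monotone hx) (hγ.monotone he)).trans le_self_add)⟩

theorem IsSISSVSR.hasLyapunovFamily (h : F.IsSISSVSR) : F.HasLyapunovFamily := by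
  obtain ⟨β, γ, hβ, hγ, h⟩ := h
  obtain ⟨α, m, hα, hm, hτ⟩ := hβ.exists_cost_gauge
  have hκ := hβ.isClassKInf_add_id
  have hmaj : ∃ α₂, IsClassKInf α₂ ∧ ∀ s, β s 0 + s + 2 * (s * m s) ≤ α₂ s := by
    refine exists_isClassKInf_ge (fun s s' hs => add_le_add (hκ.1.monotone hs)
      (mul_le_mul_right (mul_le_mul' hs (hm hs)) _)) fun ε hε => ?_
    obtain ⟨δ, hδ, hδε⟩ := hκ.1.exists_pos_forall_lt (half_pos hε)
    -- Chosen so that `η * m η ≤ ε / 4`, using `m η ≤ m 1`; the `+ 1` keeps the denominator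
    -- positive.
    set η := min δ (min 1 (ε / (4 * (m 1 + 1)))) with hη
    refine ⟨η, by positivity, ?_⟩
    have h1 : η * m η ≤ ε / 4 := by
      calc η * m η ≤ ε / (4 * (m 1 + 1)) * (m 1 + 1) :=
            mul_le_mul' ((min_le_right _ _).trans (min_le_right _ _))
              ((hm ((min_le_right _ _).trans (min_le_left _ _))).trans le_self_add)
        _ = ε / 4 := by field_simp
    calc β η 0 + η + 2 * (η * m η) ≤ ε / 2 + 2 * (ε / 4) :=
          add_le_add (hδε η (min_le_left _ _)).le (mul_le_mul_right h1 _)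
      _ = ε := by ring
  obtain ⟨α₂, hα₂, hle₂⟩ := hmaj
  have hγ4 : IsClassK fun r => 4 * γ r :=
    ⟨fun a b hab => mul_lt_mul_of_pos_left (hγ.1.1 hab) (by norm_num),
      continuous_const.mul hγ.1.continuous, by simp [hγ.1.map_zero]⟩
  refine ⟨id, α₂, α, fun r => β (4 * γ r) 0 + 4 * γ r,
    isClassKInf_of_le ⟨strictMono_id, continuous_id, rfl⟩ fun _ => le_rfl, hα₂, hα,
    ⟨hκ.1.1.comp hγ4.1, hκ.1.continuous.comp hγ4.continuous, ?_⟩, fun M E => ?_⟩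
  · simp [hγ.1.map_zero, (hβ.1 0).map_zero]
  obtain ⟨Ts, hTs, h⟩ := h M E
  have hT₀ : 0 < min Ts 1 := lt_min hTs one_pos
  refine ⟨min Ts 1, hT₀, F.worstCost (fun r => β (4 * γ r) 0 + 4 * γ r) α E (min Ts 1),
    fun x => nnnorm_le_worstCost hT₀ x, fun ξ hξ => ?_, fun x e T hρ hx he hT hTT => ?_⟩
  · have hdecay : ∀ x e T k, ‖x 0‖₊ ≤ M →
        F.IsAdmissible (fun r => β (4 * γ r) 0 + 4 * γ r) E (min Ts 1) x e T k → ∀ i ≤ k,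
        ‖x i‖₊ ≤ β ‖x 0‖₊ (∑ j ∈ Finset.range i, T j) + ‖x 0‖₊ / 4 := by
      intro x e T k hx hadm
      refine hadm.nnnorm_le hβ hγ ?_
      obtain ⟨z, hz, hle⟩ := h T
        (fun i => ⟨(hadm.2.1 i).1, (hadm.2.1 i).2.trans_le (min_le_left _ _)⟩) (x 0) hx e hadm.1
      -- The model is single-valued, so an admissible finite trajectory coincides with the solution
      -- supplied by stability and inherits its estimate.
      have heq : ∀ i ≤ k, x i = z i := by
        intro i
        induction i with
        | zero => exact fun _ => hz.1.symm
        | succ i ih =>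
          intro hi
          have h1 := (hadm.2.2 i hi).1
          rw [ih (by omega)] at h1
          exact Part.mem_unique h1 (hz.2 i)
      exact fun i hi => heq i hi ▸ hle i
    refine iSup_le fun x => iSup_le fun e => iSup_le fun T => iSup_le fun k => iSup_le ?_
    rintro ⟨rfl, hadm⟩
    refine ENNReal.coe_le_coe.2 (le_trans (add_le_add ?_ ?_) (hle₂ _))
    · exact (hdecay x e T k hξ hadm k le_rfl).trans
        (add_le_add (hβ.antitone _ zero_le) (NNReal.div_le_of_le_mul
          (le_mul_of_one_le_right zero_le (by norm_num))))
    · exact sum_cost_le hβ hα hm hτ (min_le_right _ _) hdecay hξ hadm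
  · obtain ⟨z, hz, -⟩ := h (fun _ => T) (fun _ => ⟨hT, hTT.trans_le (min_le_left _ _)⟩) x hx
      (fun _ => e) (fun _ => he)
    have hy := hz.2 0
    rw [hz.1] at hy
    exact ⟨_, hy, worstCost_add_le hy hρ he hT hTT⟩

end SampledModel

theorem theorem1 {n q : ℕ} (F : SampledModel n q) :
    F.IsSISSVSR ↔
      F.ZeroAtOrigin ∧ F.UniformlyContinuousAtOrigin ∧ F.UniformlyBounded ∧
        F.HasLyapunovFamily :=
  ⟨fun h => ⟨h.zeroAtOrigin, h.uniformlyContinuousAtOrigin, h.uniformlyBounded,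
    h.hasLyapunovFamily⟩, fun h =>
    SampledModel.isSISSVSR_of_hasLyapunovFamily h.2.1 h.2.2.1 h.2.2.2⟩
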